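/- For sets $U_1,\dots,U_n\subseteq\mathbb R^d$ (repetitions allowed), the code of $\mathcal U=\{U_1,\dots,U_n\}$ is the set of all $\sigma\subseteq[n]=\{1,\dots,n\}$ for which some $x\in\mathbb R^d$ satisfies $\{i: x\in U_i\}=\sigma$. For an integer $k\ge 0$, $\mathcal U$ is an *open $k$-flexible sunflower* if every $U_i$ is convex and open, $[n]$ belongs to the code, and every other element of the code has at most $k$ elements. That is, the *center* $U_1\cap\dots\cap U_n$ is nonempty and every point outside the center lies in at most $k$ of the sets $U_i$. (1) Let $d,k\ge 0$ be integers, let $\mathcal U=\{U_1,\dots,U_n\}$ be an open $k$-flexible sunflower in $\mathbb R^d$ with $n\ge dk+1$, and let $p_i\in U_i$ for each $i\in[n]$. Then $\operatorname{conv}\{p_1,\dots,p_n\}$ contains a point of the center of $\mathcal U$. (2) If $d\ge 2$, this may fail when $n<dk+1$: for all integers $d\ge 2$, $k\ge 1$ and $n$ with $2\le n<dk+1$ (in particular for $n=dk$) there are an open $k$-flexible sunflower $\{U_1,\dots,U_n\}$ in $\mathbb R^d$ with $\bigcup_i U_i\neq\mathbb R^d$ and points $p_i\in U_i$ such that $\operatorname{conv}\{p_1,\dots,p_n\}$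 contains no point of the center. -/

import Mathlib

namespace ConvexCode

/-- The atom of `σ`: the points that lie in every `U i` with `i ∈ σ` and in no other `U j`. -/
def atom {X : Type*} {n : ℕ} (U : Fin n → Set X) (σ : Finset (Fin n)) : Set X :=
  {x | ∀ i, x ∈ U i ↔ i ∈ σ}

/-- The code of an indexed family: the index sets whose atom is nonempty. -/
def code {X : Type*} {n : ℕ} (U : Fin n → Set X) : Set (Finset (Fin n)) :=
  {σ | (atom U σ).Nonempty}

/-- The center of a family: the intersection of all its petals. -/
def center {X : Type*} {n : ℕ} (U : Fin n → Set X) : Set X :=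
  ⋂ i, U i

/-- A `k`-flexible sunflower in `ℝ^d`: a family of convex sets such that the full index set is a
codeword and every other codeword has weight at most `k`. -/
structure IsFlexibleSunflower {d n : ℕ} (k : ℕ)
    (U : Fin n → Set (EuclideanSpace ℝ (Fin d))) : Prop where
  convex : ∀ i, Convex ℝ (U i)
  univ_mem_code : Finset.univ ∈ code U
  card_le : ∀ σ ∈ code U, σ ≠ Finset.univ → σ.card ≤ k

/-- An open `k`-flexible sunflower: a `k`-flexible sunflower with open petals. -/
structure IsOpenFlexibleSunflower {d n : ℕ} (k : ℕ)
    (U : Fin n → Set (EuclideanSpace ℝ (Fin d))) : Prop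
    extends IsFlexibleSunflower k U where
  isOpen : ∀ i, IsOpen (U i)

end ConvexCode

/-!
For the positive part, let `C` be the center and suppose that `conv {p i}` misses `C`. A hyperplane
`f = u` strictly separates `C` from slightly perturbed points `p i`, and every `U i`, which meets
both sides, contains a point `q i` of that hyperplane. The hyperplane has dimension `d - 1`, so
Helly's theorem with Helly number `d` gives a *centerpoint* `c`: as `n > d * k`, the point `c` lies
in the convex hull of every subfamily of the `q i` that omits at most `k` of them
(`exists_centerpoint_in_hyperplane`).

The other ingredient is a boundary point of `C` at which all petals have the same supporting
hyperplane. Shrink a ball inside `C` homothetically towards `c`, which lies outside the closure of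
`C`. The last ball still inside `C`, with center `z`, touches the complement of `C` in a point `x`,
and `c` lies beyond the tangent hyperplane at `x` (`exists_tangent_ball`). If `x ∉ U i`, then `U i`,
which contains the ball, lies strictly on the inner side of this tangent hyperplane
(`inner_pos_of_tangent_ball`), and so does `q i`. Since `x ∉ C`, at most `k` petals contain `x`, so
`c` is a convex combination of points `q i` on the inner side. This is a contradiction.

For the sharpness, let `C` be the open positive orthant and let `U i` be the orthant with the
constraint number `i % d` removed. A point outside `C` violates some constraint `x j > 0`, hence
lies only in petals with `i % d = j`, of which there are at most `k`. The points `p i` whose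
coordinate `i % d` is `1 - d`, the others being `1`, lie in the hyperplane of coordinate sum `0`,
which misses `C`.
-/

open Set Filter Topology Module
open scoped Pointwise

/-! ### Centerpoints in a hyperplane -/

/-- The centerpoint theorem in a hyperplane `f = u` of a space of dimension `d`: among more than
`d * k` points, the convex hulls of all subfamilies omitting at most `k` points have a common
point. Compared to the whole space, the Helly number drops from `d + 1` to `d`. -/
theorem exists_centerpoint_in_hyperplane {E ι : Type*} [AddCommGroup E] [Module ℝ E]
    [FiniteDimensional ℝ E] [Fintype ι] [DecidableEq ι] {f : E →ₗ[ℝ] ℝ} (hf : f ≠ 0)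
    {u : ℝ} {k : ℕ} {q : ι → E} (hq : ∀ i, f (q i) = u)
    (hcard : finrank ℝ E * k < Fintype.card ι) :
    ∃ c, f c = u ∧ ∀ B : Finset ι, Bᶜ.card ≤ k → c ∈ convexHull ℝ (q '' B) := by
  obtain ⟨i₀⟩ : Nonempty ι := Fintype.card_pos_iff.1 (by omega)
  have hrank := Module.Dual.finrank_ker_add_one_of_ne_zero hf
  -- Coordinates on the hyperplane with origin `q i₀`.
  let r : ι → LinearMap.ker f := fun i => ⟨q i - q i₀, by simp [hq]⟩
  let S : Finset (Finset ι) := Finset.univ.filter fun B => Bᶜ.card ≤ k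
  obtain ⟨c, hc⟩ : (⋂ B ∈ S, convexHull ℝ (r '' (B : Set ι))).Nonempty := by
    refine Convex.helly_theorem' (𝕜 := ℝ) (fun B _ => convex_convexHull ℝ _) fun I hI hIcard => ?_
    -- At most `d * k` indices are omitted by some member of `I`, so all members share an index.
    have hlt : (I.biUnion fun B => Bᶜ).card < Fintype.card ι := by
      refine (Finset.card_biUnion_le_card_mul I _ k fun B hB => ?_).trans_lt
        ((Nat.mul_le_mul_right k (hIcard.trans_eq hrank)).trans_lt hcard)
      exact (Finset.mem_filter.1 (hI hB)).2
    obtain ⟨i, hi⟩ : ∃ i, i ∉ I.biUnion fun B => Bᶜ := by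
      by_contra! h
      rw [Finset.eq_univ_iff_forall.2 h] at hlt
      exact hlt.ne Finset.card_univ
    refine ⟨r i, mem_iInter₂.2 fun B hB => subset_convexHull ℝ _ ⟨i, ?_, rfl⟩⟩
    by_contra hiB
    exact hi (Finset.mem_biUnion.2 ⟨B, hB, Finset.mem_compl.2 hiB⟩)
  refine ⟨q i₀ + c, by simp [hq], fun B hB => ?_⟩
  have hcB := mem_iInter₂.1 hc B (Finset.mem_filter.2 ⟨Finset.mem_univ _, hB⟩)
  have h1 : (c : E) ∈ convexHull ℝ ((LinearMap.ker f).subtype '' (r '' (B : Set ι))) := by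
    rw [← (LinearMap.ker f).subtype.image_convexHull]
    exact ⟨c, hcB, rfl⟩
  have h2 : (q '' (B : Set ι)) = q i₀ +ᵥ ((LinearMap.ker f).subtype '' (r '' (B : Set ι))) := by
    simp [← image_vadd, image_image, r]
  rw [h2, convexHull_vadd]
  exact ⟨c, h1, rfl⟩

/-! ### Tangent balls of open convex sets -/

section TangentBall

variable {E : Type*} [NormedAddCommGroup E] [InnerProductSpace ℝ E]

/-- If a ball inside the open convex set `U` has a boundary point `x` outside `U`, then the tangent
hyperplane of the ball at `x` supports `U`. -/
theorem inner_pos_of_tangent_ball {U : Set E} (hconv : Convex ℝ U) (hopen : IsOpen U) {x z w : E}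
    (hxz : x ≠ z) (hball : Metric.ball z (dist x z) ⊆ U) (hx : x ∉ U) (hw : w ∈ U) :
    0 < inner ℝ (z - x) (w - x) := by
  by_contra! hle
  -- Push `w` strictly beyond the tangent hyperplane.
  obtain ⟨ε, hε, hεU⟩ : ∃ ε > (0 : ℝ), w - ε • (z - x) ∈ U := by
    have hcont : Continuous fun ε : ℝ => w - ε • (z - x) := by fun_prop
    have hev : ∀ᶠ ε in 𝓝[>] (0 : ℝ), w - ε • (z - x) ∈ U :=
      (hcont.continuousAt.eventually_mem (hopen.mem_nhds (by simpa using hw))).filter_mono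
        nhdsWithin_le_nhds
    obtain ⟨ε, h1, h2⟩ := (hev.and self_mem_nhdsWithin).exists
    exact ⟨ε, h2, h1⟩
  set w' := w - ε • (z - x) with hw'
  have hneg : inner ℝ (z - x) (w' - x) < 0 := by
    have h1 : w' - x = (w - x) - ε • (z - x) := by rw [hw']; abel
    have h2 : 0 < ‖z - x‖ := norm_pos_iff.2 (sub_ne_zero.2 hxz.symm)
    rw [h1, inner_sub_right, inner_smul_right, real_inner_self_eq_norm_sq]
    have : 0 < ε * ‖z - x‖ ^ 2 := by positivity
    linarith
  -- The ray from `w'` through `x` then enters the ball, so `x` lies between two points of `U`.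
  set a := -inner ℝ (z - x) (w' - x) with ha
  have ha0 : 0 < a := by linarith
  set b := ‖w' - x‖ ^ 2 with hb
  have hb0 : 0 ≤ b := by positivity
  set δ := a / (b + 1) with hδ
  have hδ0 : 0 < δ := by positivity
  have hδb : δ * b < 2 * a := by
    have : δ * (b + 1) = a := by rw [hδ]; field_simp
    linarith
  have hv : x - δ • (w' - x) ∈ U := by
    apply hball
    rw [Metric.mem_ball, dist_eq_norm, dist_comm, dist_eq_norm]
    refine lt_of_pow_lt_pow_left₀ 2 (norm_nonneg _) ?_
    have h1 : x - δ • (w' - x) - z = -((z - x) + δ • (w' - x)) := by abel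
    rw [h1, norm_neg, norm_add_sq_real, inner_smul_right, norm_smul, mul_pow, ← hb,
      Real.norm_of_nonneg hδ0.le]
    have : δ * (δ * b) < δ * (2 * a) := mul_lt_mul_of_pos_left hδb hδ0
    have h2 : inner ℝ (z - x) (w' - x) = -a := by rw [ha]; ring
    rw [h2]
    nlinarith
  apply hx
  have hcomb := hconv hv hεU (a := 1 / (1 + δ)) (b := δ / (1 + δ)) (by positivity) (by positivity)
    (by field_simp)
  convert hcomb using 1
  have h1 : 1 / (1 + δ) * (1 + δ) = 1 := by field_simp
  have h2 : δ / (1 + δ) = 1 / (1 + δ) * δ := by ring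
  rw [h2, mul_smul, ← smul_add]
  have h3 : x - δ • (w' - x) + δ • w' = (1 + δ) • x := by rw [smul_sub, add_smul, one_smul]; abel
  rw [h3, smul_smul, h1, one_smul]

/-- An open convex set `C` has a tangent ball, with center `z` and touching point `x`, whose tangent
hyperplane strictly separates `C` from a given point `c` outside the closure of `C`. -/
theorem exists_tangent_ball [FiniteDimensional ℝ E] {C : Set E} (hconv : Convex ℝ C)
    (hopen : IsOpen C) (hne : C.Nonempty) {c : E} (hc : c ∉ closure C) :
    ∃ x z, x ≠ z ∧ x ∉ C ∧ Metric.ball z (dist x z) ⊆ C ∧ inner ℝ (z - x) (c - x) < 0 := by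
  obtain ⟨y, hy⟩ := hne
  obtain ⟨r, hr, hrC⟩ := Metric.nhds_basis_closedBall.mem_iff.1 (hopen.mem_nhds hy)
  -- Pairs `(t, v)` for which the point `v` of the ball scaled by `t` towards `c` has left `C`.
  let φ : ℝ × E → E := fun s => c + s.1 • (y + s.2 - c)
  have hφ : Continuous φ := by fun_prop
  let K : Set (ℝ × E) := (Icc 0 1 ×ˢ Metric.closedBall 0 r) ∩ φ ⁻¹' Cᶜ
  have hK : IsCompact K :=
    (isCompact_Icc.prod (isCompact_closedBall _ _)).inter_right (hopen.isClosed_compl.preimage hφ)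
  have hKne : K.Nonempty :=
    ⟨(0, 0), ⟨⟨by simp, by simp [hr.le]⟩, by simpa [φ] using fun h => hc (subset_closure h)⟩⟩
  obtain ⟨⟨t, v⟩, ⟨⟨⟨ht0, ht1⟩, hv⟩, hx⟩, hmax⟩ :=
    hK.exists_isMaxOn hKne continuous_fst.continuousOn
  simp only [mem_closedBall_zero_iff] at ht0 ht1 hv
  have hout : ∀ s, t < s → s ≤ 1 → ∀ v', ‖v'‖ ≤ r → c + s • (y + v' - c) ∈ C := by
    intro s hts hs1 v' hv'
    by_contra h
    have : s ≤ t := hmax (a := (s, v')) ⟨⟨⟨ht0.trans hts.le, hs1⟩, by simpa using hv'⟩, h⟩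
    exact this.not_gt hts
  have hyv : y + v ∈ C := hrC (by simpa using hv)
  have ht1' : t < 1 := by
    refine lt_of_le_of_ne ht1 fun h => hx ?_
    simpa [φ, h] using hyv
  have hxC : c + t • (y + v - c) ∉ C := hx
  -- The factor `t = 0` would put `c` into the closure of `C`.
  have htpos : 0 < t := by
    refine lt_of_le_of_ne ht0 fun h => hc ?_
    have hlim : Tendsto (fun s : ℝ => c + s • (y + 0 - c)) (𝓝[>] 0) (𝓝 c) := by
      have hcont : Continuous fun s : ℝ => c + s • (y + 0 - c) := by fun_prop
      simpa using (hcont.tendsto 0).mono_left (nhdsWithin_le_nhds (s := Ioi 0))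
    refine mem_closure_of_tendsto hlim ?_
    filter_upwards [Ioc_mem_nhdsGT (zero_lt_one (α := ℝ))] with s hs
    exact hout s (h ▸ hs.1) hs.2 0 (by simpa using hr.le)
  have hball : Metric.ball (c + t • (y - c)) (t * r) ⊆ C := by
    intro w hw
    rw [Metric.mem_ball, dist_eq_norm] at hw
    have hcont : Continuous fun s : ℝ => s * r - ‖w - (c + s • (y - c))‖ := by fun_prop
    have hev : ∀ᶠ s in 𝓝[>] t, 0 < s * r - ‖w - (c + s • (y - c))‖ :=
      (hcont.continuousAt.eventually_mem (Ioi_mem_nhds (sub_pos.2 hw))).filter_mono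
        nhdsWithin_le_nhds
    obtain ⟨s, hs, hts, hs1⟩ := (hev.and (Ioc_mem_nhdsGT ht1')).exists
    have hs0 : 0 < s := htpos.trans hts
    have hmem := hout s hts hs1 (s⁻¹ • (w - (c + s • (y - c)))) (by
      rw [norm_smul, Real.norm_of_nonneg (inv_nonneg.2 hs0.le), inv_mul_le_iff₀ hs0]
      linarith)
    convert hmem using 1
    rw [add_sub_right_comm, smul_add, smul_smul, mul_inv_cancel₀ hs0.ne', one_smul]
    abel
  have hdist : dist (c + t • (y + v - c)) (c + t • (y - c)) ≤ t * r := by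
    have : c + t • (y + v - c) - (c + t • (y - c)) = t • v := by module
    rw [dist_eq_norm, this, norm_smul, Real.norm_of_nonneg ht0]
    gcongr
  have hsub := (Metric.ball_subset_ball hdist).trans hball
  have hne : c + t • (y + v - c) ≠ c + t • (y - c) := by
    intro h
    exact hxC (h ▸ hball (Metric.mem_ball_self (by positivity)))
  refine ⟨_, _, hne, hxC, hsub, ?_⟩
  -- The touching point lies between `c` and the point `y + v` of `C`.
  have hpos := inner_pos_of_tangent_ball hconv hopen hne hsub hxC hyv
  set x := c + t • (y + v - c) with hxdef
  have h1 : (1 - t) • (c - x) = -(t • (y + v - x)) := by rw [hxdef]; module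
  have h2 := congrArg (inner ℝ (c + t • (y - c) - x)) h1
  rw [inner_smul_right, inner_neg_right, inner_smul_right] at h2
  have h3 := mul_pos htpos hpos
  by_contra! h4
  have h5 := mul_nonneg (sub_pos.2 ht1').le h4
  linarith

end TangentBall

namespace ConvexCode

/-! ### Transversals of large sunflowers -/

/-- A point outside the center lies in at most `k` petals. -/
theorem IsFlexibleSunflower.card_filter_mem_le {d n k : ℕ}
    {U : Fin n → Set (EuclideanSpace ℝ (Fin d))} (hU : IsFlexibleSunflower k U)
    {x : EuclideanSpace ℝ (Fin d)} (hx : x ∉ center U) [DecidablePred fun i => x ∈ U i] :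
    (Finset.univ.filter fun i => x ∈ U i).card ≤ k := by
  refine hU.card_le _ ⟨x, fun i => by simp⟩ fun h => hx (mem_iInter.2 fun i => ?_)
  simpa using h.ge (Finset.mem_univ i)

theorem IsOpenFlexibleSunflower.convexHull_inter_center_nonempty {d n k : ℕ}
    {U : Fin n → Set (EuclideanSpace ℝ (Fin d))} (hU : IsOpenFlexibleSunflower k U)
    (hn : d * k + 1 ≤ n) {p : Fin n → EuclideanSpace ℝ (Fin d)} (hp : ∀ i, p i ∈ U i) :
    (convexHull ℝ (range p) ∩ center U).Nonempty := by
  classical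
  by_contra hdisj
  have hCconv : Convex ℝ (center U) := convex_iInter hU.convex
  have hCopen : IsOpen (center U) := isOpen_iInter_of_finite hU.isOpen
  obtain ⟨y, hyU⟩ := hU.univ_mem_code
  have hy : y ∈ center U := mem_iInter.2 fun i => (hyU i).2 (Finset.mem_univ i)
  obtain ⟨f, u, hfC, hfp⟩ := geometric_hahn_banach_open hCconv hCopen (convex_convexHull ℝ (range p))
    (disjoint_iff_inter_eq_empty.2 (by rwa [inter_comm, ← not_nonempty_iff_eq_empty]))
  have hfp' : ∀ i, u ≤ f (p i) := fun i => hfp _ (subset_convexHull ℝ _ (mem_range_self i))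
  -- The direction from `y` to some `p i` increases `f`, so moving the `p i` makes the separation
  -- strict.
  obtain ⟨w, hw⟩ : ∃ w, 0 < f w :=
    ⟨p ⟨0, by omega⟩ - y, by rw [map_sub]; linarith [hfp' ⟨0, by omega⟩, hfC y hy]⟩
  have hp' : ∀ i, ∃ p' ∈ U i, u < f p' := by
    intro i
    have hcont : Continuous fun ε : ℝ => p i + ε • w := by fun_prop
    have hev : ∀ᶠ ε in 𝓝[>] (0 : ℝ), p i + ε • w ∈ U i :=
      (hcont.continuousAt.eventually_mem ((hU.isOpen i).mem_nhds (by simpa using hp i))).filter_mono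
        nhdsWithin_le_nhds
    obtain ⟨ε, h1, h2⟩ := (hev.and self_mem_nhdsWithin).exists
    refine ⟨_, h1, ?_⟩
    rw [map_add, map_smul, smul_eq_mul]
    linarith [hfp' i, mul_pos (mem_Ioi.1 h2) hw]
  choose p' hp'U hup' using hp'
  obtain ⟨u', hu', huu'⟩ : ∃ u', (∀ i, u' < f (p' i)) ∧ u < u' := by
    have hev : ∀ᶠ u' in 𝓝[>] u, ∀ i, u' < f (p' i) :=
      eventually_all.2 fun i => nhdsWithin_le_nhds (Iio_mem_nhds (hup' i))
    exact (hev.and self_mem_nhdsWithin).exists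
  have hq : ∀ i, ∃ q ∈ U i, f q = u' := by
    intro i
    obtain ⟨q, hqU, hqf⟩ := (hU.convex i).isPreconnected.intermediate_value (mem_iInter.1 hy i)
      (hp'U i) f.continuous.continuousOn ⟨((hfC y hy).trans huu').le, (hu' i).le⟩
    exact ⟨q, hqU, hqf⟩
  choose q hqU hqf using hq
  have hf0 : (f : EuclideanSpace ℝ (Fin d) →ₗ[ℝ] ℝ) ≠ 0 := by
    intro h
    exact hw.ne' (LinearMap.congr_fun h w)
  obtain ⟨c, hcu, hc⟩ := exists_centerpoint_in_hyperplane (k := k) hf0 hqf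
    (by simpa using hn)
  have hcC : c ∉ closure (center U) := by
    intro h
    have : f c ≤ u :=
      closure_minimal (fun a ha => (hfC a ha).le) (isClosed_le f.continuous continuous_const) h
    exact this.not_gt (huu'.trans_eq hcu.symm)
  obtain ⟨x, z, hxz, hxC, hball, hneg⟩ := exists_tangent_ball hCconv hCopen ⟨y, hy⟩ hcC
  have hmem : c ∈ convexHull ℝ (q '' (Finset.univ.filter fun i => x ∉ U i : Finset (Fin n))) := by
    refine hc _ ?_
    rw [Finset.compl_filter]
    simpa using hU.card_filter_mem_le hxC
  -- All `q i` with `x ∉ U i` lie in the inner open half-space at `x`, which is convex.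
  have hhalf : Convex ℝ {a | inner ℝ (z - x) x < inner ℝ (z - x) a} :=
    convex_halfSpace_gt (innerₛₗ ℝ (z - x)).isLinear _
  have hin := convexHull_min (fun a ha => ?_) hhalf hmem
  · rw [inner_sub_right] at hneg
    exact lt_asymm (sub_neg.1 hneg) hin
  · obtain ⟨i, hi, rfl⟩ := ha
    have := inner_pos_of_tangent_ball (hU.convex i) (hU.isOpen i) hxz
      (hball.trans (iInter_subset _ i)) (by simpa using hi) (hqU i)
    rw [inner_sub_right] at this
    exact sub_pos.1 this

/-! ### Small sunflowers without central transversals -/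

/-- The open positive orthant of `ℝ^d` with the constraint `0 < x (i % d)` removed. -/
def orthantPetal (d n : ℕ) (i : Fin n) : Set (EuclideanSpace ℝ (Fin d)) :=
  {x | ∀ j : Fin d, (j : ℕ) ≠ i % d → 0 < x j}

theorem center_orthantPetal {d n : ℕ} (hd : 2 ≤ d) (hn : 2 ≤ n) :
    center (orthantPetal d n) = {x | ∀ j, 0 < x j} := by
  ext x
  refine ⟨fun hx j => ?_, fun hx => mem_iInter.2 fun i j _ => hx j⟩
  rw [center, mem_iInter] at hx
  -- The petals `0` and `1` lack different constraints.
  by_cases hj : (j : ℕ) = 0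
  · exact hx ⟨1, by omega⟩ j (by rw [hj, Nat.mod_eq_of_lt (show 1 < d by omega)]; omega)
  · exact hx ⟨0, by omega⟩ j (by simpa using hj)

theorem isOpenFlexibleSunflower_orthantPetal {d k n : ℕ} (hd : 2 ≤ d) (hn : 2 ≤ n)
    (hnk : n ≤ d * k) : IsOpenFlexibleSunflower k (orthantPetal d n) where
  convex i := by
    intro x hx y hy a b ha hb hab j hj
    have hxy := (convex_Ioi (0 : ℝ)) (hx j hj) (hy j hj) ha hb hab
    simpa using hxy
  isOpen i := by
    simp only [orthantPetal, ofPred_forall]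
    exact isOpen_iInter_of_finite fun j => isOpen_iInter_of_finite fun _ =>
      isOpen_lt continuous_const (by fun_prop)
  univ_mem_code := by
    refine ⟨WithLp.toLp 2 fun _ => 1, fun i => ?_⟩
    simp [orthantPetal]
  card_le := by
    rintro σ ⟨x, hx⟩ hσ
    have hxC : x ∉ center (orthantPetal d n) := by
      intro h
      exact hσ (Finset.eq_univ_of_forall fun i => (hx i).1 (mem_iInter.1 h i))
    rw [center_orthantPetal hd hn, mem_ofPred_eq] at hxC
    push Not at hxC
    obtain ⟨j, hj⟩ := hxC
    have hmod : ∀ i ∈ σ, (j : ℕ) = i % d := by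
      intro i hi
      by_contra h
      exact ((hx i).2 hi j h).not_ge hj
    -- Indices with equal residue modulo `d` are told apart by their quotient, which is below `k`.
    rw [← Finset.card_range k]
    refine Finset.card_le_card_of_injOn (fun i : Fin n => (i : ℕ) / d) (fun i _ => ?_) ?_
    · exact Finset.mem_coe.2 (Finset.mem_range.2 (Nat.div_lt_of_lt_mul (i.2.trans_le hnk)))
    · intro i hi i' hi' h
      have h : (i : ℕ) / d = i' / d := h
      rw [Fin.ext_iff, ← Nat.div_add_mod (i : ℕ) d, ← Nat.div_add_mod (i' : ℕ) d, h,
        ← hmod i hi, ← hmod i' hi']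

theorem exists_transversal_orthantPetal_disjoint {d n : ℕ} (hd : 2 ≤ d) (hn : 2 ≤ n) :
    ∃ p : Fin n → EuclideanSpace ℝ (Fin d), (∀ i, p i ∈ orthantPetal d n i) ∧
      Disjoint (convexHull ℝ (range p)) (center (orthantPetal d n)) := by
  refine ⟨fun i => WithLp.toLp 2 fun j => if (j : ℕ) = i % d then 1 - (d : ℝ) else 1,
    fun i j hj => by simp [hj], ?_⟩
  let s : EuclideanSpace ℝ (Fin d) →ₗ[ℝ] ℝ := ∑ j, (EuclideanSpace.proj j).toLinearMap
  have hs : ∀ x, s x = ∑ j, x j := fun x => by simp [s]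
  have hconv : Convex ℝ {x | s x ≤ 0} := convex_halfSpace_le s.isLinear 0
  refine disjoint_left.2 fun x hx hxC => ?_
  rw [center_orthantPetal hd hn] at hxC
  have : s x ≤ 0 := by
    refine convexHull_min ?_ hconv hx
    rintro _ ⟨i, rfl⟩
    have hlt : (i : ℕ) % d < d := Nat.mod_lt _ (by omega)
    have hsplit : ∀ j : Fin d, (if (j : ℕ) = i % d then 1 - (d : ℝ) else 1) =
        1 - if j = ⟨i % d, hlt⟩ then (d : ℝ) else 0 := by
      intro j
      simp only [Fin.ext_iff]
      split_ifs <;> ring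
    simp [hs, hsplit]
  rw [hs] at this
  have hne : (Finset.univ : Finset (Fin d)).Nonempty := ⟨⟨0, by omega⟩, Finset.mem_univ _⟩
  exact (Finset.sum_pos (fun j _ => hxC j) hne).not_ge this

theorem empty_mem_code_orthantPetal {d n : ℕ} (hd : 2 ≤ d) : ∅ ∈ code (orthantPetal d n) := by
  refine ⟨0, fun i => ⟨fun h => ?_, fun h => absurd h (Finset.notMem_empty i)⟩⟩
  -- As `d ≥ 2`, each petal retains one of the first two constraints.
  by_cases hi : (i : ℕ) % d = 0
  · exact absurd (h ⟨1, by omega⟩ (by simp [hi])) (lt_irrefl _)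
  · exact absurd (h ⟨0, by omega⟩ (Ne.symm hi)) (lt_irrefl _)

end ConvexCode

theorem mainTheorem4 :
    (∀ (d k n : ℕ) (U : Fin n → Set (EuclideanSpace ℝ (Fin d))),
      ConvexCode.IsOpenFlexibleSunflower k U → d * k + 1 ≤ n →
      ∀ p : Fin n → EuclideanSpace ℝ (Fin d), (∀ i, p i ∈ U i) →
        (convexHull ℝ (Set.range p) ∩ ConvexCode.center U).Nonempty) ∧
    (∀ d k n : ℕ, 2 ≤ d → 1 ≤ k → 2 ≤ n → n < d * k + 1 →
      ∃ U : Fin n → Set (EuclideanSpace ℝ (Fin d)),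
        ConvexCode.IsOpenFlexibleSunflower k U ∧ ∅ ∈ ConvexCode.code U ∧
        ∃ p : Fin n → EuclideanSpace ℝ (Fin d), (∀ i, p i ∈ U i) ∧
          Disjoint (convexHull ℝ (Set.range p)) (ConvexCode.center U)) :=
  ⟨fun _ _ _ _ hU hn _ hp => hU.convexHull_inter_center_nonempty hn hp,
    fun d _ n hd _ hn hnk => ⟨ConvexCode.orthantPetal d n,
      ConvexCode.isOpenFlexibleSunflower_orthantPetal hd hn (Nat.le_of_lt_succ hnk),
      ConvexCode.empty_mem_code_orthantPetal hd,
      ConvexCode.exists_transversal_orthantPetal_disjoint hd hn⟩⟩
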